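/- Let $R$ be a commutative ring and let $I,J\subseteq R$ be Tor-independent ideals, i.e. $\operatorname{Tor}^R_i(R/I,R/J)=0$ for all $i\ge 1$. Let $X$ and $Y$ be free resolutions of $R/I$ and $R/J$ over $R$, with $X_0\cong R$ and $Y_0\cong R$. The star product $X\star Y$ is the complex of free $R$-modules with $$(X\star Y)_0=X_0\otimes_R Y_0,\qquad (X\star Y)_n=\bigoplus_{\substack{i,j\ge 1\\ i+j=n+1}}X_i\otimes_R Y_j\quad(n\ge 1),$$ whose differential is $\partial_1^X\otimes\partial_1^Y$ from degree $1$ to degree $0$, and in degrees $n\ge 2$ sends $a\otimes b\in X_i\otimes_R Y_j$ to $\partial^X a\otimes b+(-1)^i a\otimes\partial^Y b$, where the first term is omitted if $i=1$ and the second is omitted if $j=1$. Then $X\star Y$ is a free resolution of $R/IJ$ over $R$, again with $(X\star Y)_0\cong R$, and all its terms have finite rank if this is so for $X$ and $Y$. Call a complex $Z$ minimal with respect to an ideal $\mathfrak m$ if $\operatorname{im}\partial^Z\subseteq\mathfrak m Z$. * If $R$ is local with maximal ideal $\mathfrak m$, and $X$ and $Y$ are minimal with respect to $\mathfrak m$,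 then so is $X\star Y$. * If $R=\bigoplus_{d\ge 0}R_d$ is a standard graded algebra over a field $k$ ($R_0=k\neq 0$, $\dim_k R_1<\infty$, and $R$ is generated by $R_1$), with $\mathfrak m=\bigoplus_{d\ge1}R_d$, and $X$ and $Y$ are minimal with respect to $\mathfrak m$, then so is $X\star Y$. Moreover, if $X$ and $Y$ are graded, then so is $X\star Y$; here a complex of free modules is called graded if its terms have bases whose elements can be assigned integer degrees (all equal to $0$ in homological degree $0$) such that all differentials are homogeneous of degree $0$. -/

import Mathlib

open CategoryTheory TensorProduct DirectSum

universe u w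

namespace StarResolution

noncomputable section

/-! ## Free resolutions, minimality, Tor-independence -/

/-- A chain complex `⋯ → X₂ → X₁ → X₀` of `R`-modules is a free resolution of the `R`-module `M`:
every term is free, it is exact in positive degrees, and there is an augmentation `ε : X₀ → M`
such that `X₁ → X₀ → M → 0` is exact. -/
structure IsFreeResolution {R : Type u} [CommRing R] (X : ChainComplex (ModuleCat.{u} R) ℕ)
    (M : Type u) [AddCommGroup M] [Module R M] : Prop where
  free : ∀ n, Module.Free R (X.X n)
  exact : ∀ n, Function.Exact (X.d (n + 2) (n + 1)).hom (X.d (n + 1) n).hom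
  augmentation : ∃ ε : X.X 0 →ₗ[R] M,
    Function.Surjective ε ∧ Function.Exact (X.d 1 0).hom ε

/-- A complex is minimal with respect to the ideal `𝔪` if the image of its differential lies in
`𝔪 X`. -/
def IsMinimal {R : Type u} [CommRing R] (𝔪 : Ideal R)
    (X : ChainComplex (ModuleCat.{u} R) ℕ) : Prop :=
  ∀ n, LinearMap.range (X.d (n + 1) n).hom ≤ 𝔪 • (⊤ : Submodule R (X.X n))

/-- Two ideals `I`, `J` are Tor-independent if `Tor_i(R/I, R/J) = 0` for all `i ≥ 1`. -/
def TorIndependent {R : Type u} [CommRing R] (I J : Ideal R) : Prop :=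
  ∀ i : ℕ, 1 ≤ i → Limits.IsZero
    (((Tor (ModuleCat.{u} R) i).obj (ModuleCat.of R (R ⧸ I))).obj (ModuleCat.of R (R ⧸ J)))

/-! ## The star product -/

section Star

variable {R : Type u} [CommRing R] (X Y : ChainComplex (ModuleCat.{u} R) ℕ)

/-- The pairs `(i, j)` with `i, j ≥ 1` and `i + j = n + 1`: the positions of the summands
`X_i ⊗ Y_j` of `(X_{≥ 1} ⊗ Y_{≥ 1})_{n + 1}`. -/
abbrev StarIdx (n : ℕ) : Type :=
  {p : ℕ × ℕ // 1 ≤ p.1 ∧ 1 ≤ p.2 ∧ p.1 + p.2 = n + 1}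

/-- The module `(X_{≥ 1} ⊗ Y_{≥ 1})_{n + 1}`, the direct sum of the `X_i ⊗ Y_j` with `i, j ≥ 1` and
`i + j = n + 1`. -/
abbrev PosTerm (n : ℕ) : Type u := ⨁ p : StarIdx n, X.X p.1.1 ⊗[R] Y.X p.1.2

/-- The differential of `X_{≥ 1} ⊗ Y_{≥ 1}` from degree `n + 3` to degree `n + 2`, restricted to
the summand `X_i ⊗ Y_j`: it sends `a ⊗ b` to `∂a ⊗ b + (-1)^i a ⊗ ∂b`, where the first term
is dropped when `i = 1` and the second one is dropped when `j = 1`. -/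
def starComponent (n : ℕ) (p : StarIdx (n + 2)) :
    X.X p.1.1 ⊗[R] Y.X p.1.2 →ₗ[R] PosTerm X Y (n + 1) :=
  (if h : 1 < p.1.1 then
    DirectSum.lof R (StarIdx (n + 1)) (fun q => X.X q.1.1 ⊗[R] Y.X q.1.2)
        ⟨(p.1.1 - 1, p.1.2), by have := p.2; simp only; omega⟩ ∘ₗ
      TensorProduct.map (X.d p.1.1 (p.1.1 - 1)).hom LinearMap.id
   else 0) +
  (if h : 1 < p.1.2 then
    (-1 : R) ^ p.1.1 •
      (DirectSum.lof R (StarIdx (n + 1)) (fun q => X.X q.1.1 ⊗[R] Y.X q.1.2)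
        ⟨(p.1.1, p.1.2 - 1), by have := p.2; simp only; omega⟩ ∘ₗ
      TensorProduct.map LinearMap.id (Y.d p.1.2 (p.1.2 - 1)).hom)
   else 0)

/-- The differential of `X_{≥ 1} ⊗ Y_{≥ 1}` from degree `n + 3` to degree `n + 2`. -/
def posDiff (n : ℕ) : PosTerm X Y (n + 2) →ₗ[R] PosTerm X Y (n + 1) :=
  DirectSum.toModule R (StarIdx (n + 2)) (PosTerm X Y (n + 1)) (starComponent X Y n)

/-- The map `∂₁ ⊗ ∂₁ : X₁ ⊗ Y₁ → X₀ ⊗ Y₀`; the only index in `StarIdx 1` is `(1, 1)`. -/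
def augDiff : PosTerm X Y 1 →ₗ[R] X.X 0 ⊗[R] Y.X 0 :=
  DirectSum.toModule R (StarIdx 1) (X.X 0 ⊗[R] Y.X 0)
    fun p => TensorProduct.map (X.d p.1.1 0).hom (Y.d p.1.2 0).hom

/-- The terms of the star product: `X₀ ⊗ Y₀` in degree `0`, and
`(X_{≥ 1} ⊗ Y_{≥ 1})_{n + 1}` in degree `n ≥ 1`. -/
def starX : ℕ → ModuleCat.{u} R
  | 0 => ModuleCat.of R (X.X 0 ⊗[R] Y.X 0)
  | n + 1 => ModuleCat.of R (PosTerm X Y (n + 1))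

/-- The differential of the star product: `∂₁ ⊗ ∂₁` in degree `1`, and the differential of
`X_{≥ 1} ⊗ Y_{≥ 1}` one degree higher in degrees `≥ 2`. -/
def starD : ∀ n : ℕ, starX X Y (n + 1) ⟶ starX X Y n
  | 0 => ModuleCat.ofHom (augDiff X Y)
  | n + 1 => ModuleCat.ofHom (posDiff X Y n)

theorem d_apply_d (i j k : ℕ) (x : X.X i) : (X.d j k).hom ((X.d i j).hom x) = 0 := by
  rw [← LinearMap.comp_apply, ← ModuleCat.hom_comp, X.d_comp_d]; rfl

theorem starComponent_tmul (n i j : ℕ) (hp : 1 ≤ i ∧ 1 ≤ j ∧ i + j = n + 2 + 1)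
    (a : X.X i) (b : Y.X j) :
    starComponent X Y n ⟨(i, j), hp⟩ (a ⊗ₜ[R] b) =
      (if h : 1 < i then
        DirectSum.lof R (StarIdx (n + 1)) (fun q => X.X q.1.1 ⊗[R] Y.X q.1.2)
          ⟨(i - 1, j), by simp only; omega⟩ ((X.d i (i - 1)).hom a ⊗ₜ[R] b)
       else 0) +
      (if h : 1 < j then
        (-1 : R) ^ i • DirectSum.lof R (StarIdx (n + 1)) (fun q => X.X q.1.1 ⊗[R] Y.X q.1.2)
          ⟨(i, j - 1), by simp only; omega⟩ (a ⊗ₜ[R] (Y.d j (j - 1)).hom b)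
       else 0) := by
  unfold starComponent
  split_ifs <;> simp

theorem augDiff_comp_posDiff : augDiff X Y ∘ₗ posDiff X Y 0 = 0 := by
  refine DirectSum.linearMap_ext R fun p => TensorProduct.ext' fun a b => ?_
  obtain ⟨⟨i, j⟩, hp⟩ := p
  simp only [augDiff, posDiff, LinearMap.comp_apply, DirectSum.toModule_lof, LinearMap.zero_apply]
  erw [starComponent_tmul X Y 0 i j hp a b]
  split_ifs <;> simp [DirectSum.toModule_lof, d_apply_d]

theorem posDiff_comp_posDiff (n : ℕ) : posDiff X Y n ∘ₗ posDiff X Y (n + 1) = 0 := by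
  refine DirectSum.linearMap_ext R fun p => TensorProduct.ext' fun a b => ?_
  obtain ⟨⟨i, j⟩, hp⟩ := p
  simp only [posDiff, LinearMap.comp_apply, DirectSum.toModule_lof, LinearMap.zero_apply]
  erw [starComponent_tmul X Y (n + 1) i j hp a b]
  have hlof (i j : ℕ) (hp : 1 ≤ i ∧ 1 ≤ j ∧ i + j = n + 2 + 1) (a : X.X i) (b : Y.X j) :
      DirectSum.toModule R (StarIdx (n + 2)) (PosTerm X Y (n + 1)) (starComponent X Y n)
        (DirectSum.lof R (StarIdx (n + 2)) (fun q => X.X q.1.1 ⊗[R] Y.X q.1.2)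
          ⟨(i, j), hp⟩ (a ⊗ₜ[R] b)) = _ :=
    (DirectSum.toModule_lof ..).trans (starComponent_tmul X Y n i j hp a b)
  simp only [map_add]
  obtain ⟨i, rfl⟩ := Nat.exists_eq_add_of_le' hp.1
  split_ifs with h1 h2 h2
  · simp only [map_smul]
    erw [hlof, hlof]
    split_ifs <;> first | omega | (simp [d_apply_d, pow_succ]; rw [← add_smul, add_neg_cancel, zero_smul])
  · simp only [map_zero]
    erw [hlof]
    split_ifs <;> first | omega | simp [d_apply_d]
  · simp only [map_smul, map_zero]
    erw [hlof]
    split_ifs <;> first | omega | simp [d_apply_d]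
  · simp

theorem starD_comp_starD : ∀ n : ℕ, starD X Y (n + 1) ≫ starD X Y n = 0
  | 0 => ModuleCat.hom_ext (augDiff_comp_posDiff X Y)
  | n + 1 => ModuleCat.hom_ext (posDiff_comp_posDiff X Y n)

/-- The star product `X ⋆ Y`: truncate, tensor, shift, augment. -/
def starProduct : ChainComplex (ModuleCat.{u} R) ℕ :=
  ChainComplex.of (starX X Y) (starD X Y) (starD_comp_starD X Y)

end Star

/-! ## The graded setting -/

section Graded

variable {k : Type w} [Field k] {R : Type u} [CommRing R] [Algebra k R]

/-- `R = ⨁ 𝒜 n` is a standard graded `k`-algebra: `R₀ = k`, and `R` is generated over `k` by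
the finite-dimensional space `R₁`. -/
structure IsStandardGraded (𝒜 : ℕ → Submodule k R) [GradedAlgebra 𝒜] : Prop where
  nontrivial : Nontrivial R
  degree_zero : 𝒜 0 = Subalgebra.toSubmodule (⊥ : Subalgebra k R)
  finite_degree_one : Module.Finite k (𝒜 1)
  generated : Algebra.adjoin k (𝒜 1 : Set R) = ⊤

/-- The homogeneous elements of degree `d ∈ ℤ` (only `0` if `d < 0`). -/
def degreePart (𝒜 : ℕ → Submodule k R) (d : ℤ) : Submodule k R :=
  if 0 ≤ d then 𝒜 d.toNat else ⊥

/-- `X` is a graded complex of graded free modules `X_n = ⨁_i R(-δ_i)`, with differentials of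
degree `0` and with `X₀` generated in degree `0`: there are bases of the `X_n` and degrees of
their elements for which the entry at `(j, i)` of the matrix of `∂ : X_{n + 1} → X_n` is
homogeneous of degree `δ_i - δ_j`. -/
def IsGradedFree (𝒜 : ℕ → Submodule k R) (X : ChainComplex (ModuleCat.{u} R) ℕ) : Prop :=
  ∃ (ι : ℕ → Type u) (b : ∀ n, Module.Basis (ι n) R (X.X n)) (δ : ∀ n, ι n → ℤ),
    (∀ i, δ 0 i = 0) ∧
    ∀ (n : ℕ) (i : ι (n + 1)) (j : ι n),
      (b n).repr ((X.d (n + 1) n).hom (b (n + 1) i)) j ∈ degreePart 𝒜 (δ (n + 1) i - δ n j)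

end Graded

end

end StarResolution

namespace StarResolution

/-! ## Tor-independence in terms of a free resolution -/

section Tor

variable {R : Type u} [CommRing R]

/-! In positive degrees `X ⋆ Y` is the shifted total complex of the double complex `X_i ⊗ Y_j`, `i,
j ≥ 1`. Call `i` the column and `j` the row. Each `Y_j` is flat, so the rows are exact except at
column 1, where the cokernel is the image of `X₁ ⊗ Y_j` in `X₀ ⊗ Y_j ≅ Y_j`, that is, `I Y_j`. A
staircase argument (`exists_posDiff_eq`) therefore reduces exactness of `X ⋆ Y` to the vanishing of
the homology of `I Y` in degrees `n ≥ 1`.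

By the long exact sequence of `0 → I Y → Y → R/I ⊗ Y → 0`, this homology sits between
`Tor_{n+1}(R/I, R/J)` and `H_n(Y)`, both zero; `TorIndependent.exists_lTensor_rTensor_eq` is the
corresponding diagram chase. In degree 0, the image of `∂₁ ⊗ ∂₁` in `R ⊗ R ≅ R` is generated by the
products of elements of `I` and `J` (`exists_augmentation_augDiff`).

Minimality and the grading are checked on pure tensors, one summand of the differential at a time.
-/

theorem IsFreeResolution.exists_projectiveResolution {X : ChainComplex (ModuleCat.{u} R) ℕ}
    {M : Type u} [AddCommGroup M] [Module R M] (hX : IsFreeResolution X M) :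
    ∃ P : ProjectiveResolution (ModuleCat.of R M), P.complex = X := by
  obtain ⟨ε, hε, hexact⟩ := hX.augmentation
  have hcomp : X.d 1 0 ≫ ModuleCat.ofHom ε = 0 := by
    ext x
    exact hexact.apply_apply_eq_zero x
  have hproj (n : ℕ) : Projective (X.X n) :=
    have := hX.free n
    ModuleCat.projective_of_free (Module.Free.chooseBasis R (X.X n))
  refine ⟨{ complex := X
            projective := hproj
            π := (ChainComplex.toSingle₀Equiv X (ModuleCat.of R M)).symm ⟨ModuleCat.ofHom ε, hcomp⟩
            quasiIso := ⟨fun n => ?_⟩ }, rfl⟩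
  cases n with
  | zero =>
    -- In degree 0 the quasi-isomorphism condition amounts to exactness of `X₁ → X₀ → M` and
    -- surjectivity of `ε`.
    rw [ChainComplex.quasiIsoAt₀_iff,
      ShortComplex.quasiIso_iff_of_zeros' _ (X.shape _ _ (by simp)) rfl rfl]
    constructor
    · rw [ShortComplex.ShortExact.moduleCat_exact_iff_function_exact]
      simpa [ChainComplex.toSingle₀Equiv] using! hexact
    · rw [ModuleCat.epi_iff_surjective]
      simpa [ChainComplex.toSingle₀Equiv] using! hε
  | succ n =>
    rw [quasiIsoAt_iff_exactAt' (hL := ChainComplex.exactAt_succ_single_obj ..),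
      HomologicalComplex.exactAt_iff' _ (n + 2) (n + 1) n (by simp) (by simp),
      ShortComplex.ShortExact.moduleCat_exact_iff_function_exact]
    exact hX.exact n

/-- `Tor_{n+1}(R/I, -)` is a left derived functor of `R/I ⊗ -`, so it may be computed from the
resolution `Y`. -/
theorem TorIndependent.lTensor_exact {I J : Ideal R} (hIJ : TorIndependent I J)
    {Y : ChainComplex (ModuleCat.{u} R) ℕ} (hY : IsFreeResolution Y (R ⧸ J)) (n : ℕ) :
    Function.Exact ((Y.d (n + 2) (n + 1)).hom.lTensor (R ⧸ I))
      ((Y.d (n + 1) n).hom.lTensor (R ⧸ I)) := by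
  obtain ⟨P, rfl⟩ := hY.exists_projectiveResolution
  have h := (hIJ (n + 1) (by omega)).of_iso
    (P.isoLeftDerivedObj ((MonoidalCategory.tensoringLeft _).obj (ModuleCat.of R (R ⧸ I)))
      (n + 1)).symm
  have h' := (HomologicalComplex.exactAt_iff_isZero_homology _ _).mpr h
  rw [HomologicalComplex.exactAt_iff' _ (n + 2) (n + 1) n (by simp) (by simp),
      ShortComplex.ShortExact.moduleCat_exact_iff_function_exact] at h'
  exact h'

end Tor

/-! ## Exactness of the star product -/

section Exactness

variable {R : Type u} [CommRing R] {X Y : ChainComplex (ModuleCat.{u} R) ℕ}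

theorem posDiff_lof (n : ℕ) (p : StarIdx (n + 2)) (x : X.X p.1.1 ⊗[R] Y.X p.1.2) :
    posDiff X Y n (DirectSum.lof R (StarIdx (n + 2))
      (fun q => X.X q.1.1 ⊗[R] Y.X q.1.2) p x) = starComponent X Y n p x :=
  DirectSum.toModule_lof ..

theorem lof_apply_of_ne {n : ℕ} {p q : StarIdx n} (h : p ≠ q) (x : X.X p.1.1 ⊗[R] Y.X p.1.2) :
    (DirectSum.lof R (StarIdx n) (fun q => X.X q.1.1 ⊗[R] Y.X q.1.2) p x) q = 0 :=
  DFinsupp.single_eq_of_ne h.symm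

theorem lof_apply_self {n : ℕ} (p : StarIdx n) (x : X.X p.1.1 ⊗[R] Y.X p.1.2) :
    (DirectSum.lof R (StarIdx n) (fun q => X.X q.1.1 ⊗[R] Y.X q.1.2) p x) p = x :=
  DirectSum.lof_apply ..

/-- Coordinate form of the differential: only the right and upper neighbours of `(i, j)` contribute
to its entry there. The truncation conditions disappear, since `i + 1` and `j + 1` exceed 1. -/
theorem posDiff_apply (n i j : ℕ) (hi : 1 ≤ i) (hj : 1 ≤ j) (hij : i + j = n + 2)
    (z : PosTerm X Y (n + 2)) :
    posDiff X Y n z ⟨(i, j), hi, hj, hij⟩ =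
      (X.d (i + 1) i).hom.rTensor (Y.X j) (z ⟨(i + 1, j), by simp only; omega⟩) +
      (-1 : R) ^ i •
        (Y.d (j + 1) j).hom.lTensor (X.X i) (z ⟨(i, j + 1), by simp only; omega⟩) := by
  induction z using DirectSum.induction_on with
  | zero => simp
  | add x y hx hy =>
    rw [map_add, DirectSum.add_apply, hx, hy]
    simp only [DirectSum.add_apply, map_add, smul_add]
    abel
  | of p x =>
    obtain ⟨⟨a, b⟩, ha, hb, hab⟩ := p
    simp only at ha hb hab x
    rw [← DirectSum.lof_eq_of R]
    erw [posDiff_lof]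
    simp only [starComponent, LinearMap.add_apply, DirectSum.add_apply]
    congr 1
    · by_cases h : a = i + 1 ∧ b = j
      · obtain ⟨rfl, rfl⟩ := h
        rw [dif_pos (by omega)]
        erw [lof_apply_self ⟨(_, _), ha, hb, hab⟩, lof_apply_self ⟨(_, _), _⟩]
        rfl
      · rw [lof_apply_of_ne (by simpa using h), map_zero]
        split_ifs with h1
        · exact lof_apply_of_ne (by simp; omega) _
        · rfl
    · by_cases h : a = i ∧ b = j + 1
      · obtain ⟨rfl, rfl⟩ := h
        rw [dif_pos (by omega), LinearMap.smul_apply, DirectSum.smul_apply]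
        erw [lof_apply_self ⟨(_, _), ha, hb, hab⟩, lof_apply_self ⟨(_, _), _⟩]
        rfl
      · rw [lof_apply_of_ne (by simpa using h), map_zero, smul_zero]
        split_ifs with h1
        · rw [LinearMap.smul_apply, DirectSum.smul_apply]
          erw [lof_apply_of_ne (by simp; omega) _]
          exact smul_zero _
        · rfl

/-- The components of a cycle of `X_{≥ 1} ⊗ Y_{≥ 1}`; in the lowest degree every element
qualifies. -/
def IsPosCycle {n : ℕ} (z : PosTerm X Y (n + 1)) : Prop :=
  ∀ (i j : ℕ) (hi : 1 ≤ i) (hj : 1 ≤ j) (hij : i + j = n + 1),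
    (X.d (i + 1) i).hom.rTensor (Y.X j) (z ⟨(i + 1, j), by simp only; omega⟩) +
      (-1 : R) ^ i •
        (Y.d (j + 1) j).hom.lTensor (X.X i) (z ⟨(i, j + 1), by simp only; omega⟩) = 0

theorem isPosCycle_iff {n : ℕ} (z : PosTerm X Y (n + 2)) :
    IsPosCycle z ↔ posDiff X Y n z = 0 := by
  refine ⟨fun h => DFinsupp.ext fun ⟨⟨i, j⟩, hi, hj, hij⟩ => ?_, fun h i j hi hj hij => ?_⟩
  · exact (posDiff_apply n i j hi hj hij z).trans (h i j hi hj hij)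
  · rw [← posDiff_apply n i j hi hj hij z, h]
    rfl

theorem isPosCycle_posDiff {n : ℕ} (y : PosTerm X Y (n + 2)) : IsPosCycle (posDiff X Y n y) := by
  cases n with
  | zero =>
    intro i j hi hj hij
    omega
  | succ n =>
    rw [isPosCycle_iff]
    exact LinearMap.congr_fun (posDiff_comp_posDiff X Y n) y

theorem IsPosCycle.sub {n : ℕ} {z z' : PosTerm X Y (n + 1)} (h : IsPosCycle z)
    (h' : IsPosCycle z') : IsPosCycle (z - z') := by
  intro i j hi hj hij
  have h1 := h i j hi hj hij
  have h2 := h' i j hi hj hij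
  rw [DirectSum.sub_apply, DirectSum.sub_apply, map_sub, map_sub, smul_sub]
  rw [sub_add_sub_comm, h1, h2, sub_zero]

/-- A cycle supported in the columns `i > k` whose entry in column `k + 1` is a horizontal cycle is
a boundary if the rows are exact. -/
theorem IsPosCycle.exists_posDiff_eq
    (hrow : ∀ i j, Function.Exact ((X.d (i + 2) (i + 1)).hom.rTensor (Y.X j))
      ((X.d (i + 1) i).hom.rTensor (Y.X j)))
    {n : ℕ} (m : ℕ) : ∀ (k : ℕ) (hkm : k + m = n + 1) (z : PosTerm X Y (n + 1)),
    IsPosCycle z → (∀ p : StarIdx (n + 1), p.1.1 ≤ k → z p = 0) →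
    (∀ hm : 1 ≤ m, (X.d (k + 1) k).hom.rTensor (Y.X m)
      (z ⟨(k + 1, m), by simp only; omega⟩) = 0) →
    ∃ y, posDiff X Y n y = z := by
  induction m with
  | zero =>
    intro k hkm z _ h0 _
    -- Now `k = n + 1`, and every index has column at most `n + 1`, so `z = 0`.
    refine ⟨0, ?_⟩
    rw [map_zero]
    refine DFinsupp.ext fun p => (h0 p ?_).symm
    have := p.2
    omega
  | succ m ih =>
    intro k hkm z hz h0 hk
    obtain ⟨x, hx⟩ := (hrow k (m + 1) _).mp (hk (by omega))
    let y := DirectSum.lof R (StarIdx (n + 2)) (fun q => X.X q.1.1 ⊗[R] Y.X q.1.2)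
      ⟨(k + 2, m + 1), by simp only; omega⟩ x
    have hz' : IsPosCycle (z - posDiff X Y n y) := hz.sub (isPosCycle_posDiff y)
    have h0' : ∀ p : StarIdx (n + 1), p.1.1 ≤ k + 1 → (z - posDiff X Y n y) p = 0 := by
      rintro ⟨⟨i, j⟩, hi, hj, hij⟩ hik
      simp only at hi hj hij hik
      rw [DirectSum.sub_apply, posDiff_apply n i j hi hj (by omega)]
      rw [lof_apply_of_ne (q := ⟨(i, j + 1), _⟩) (by simp; omega), map_zero, smul_zero, add_zero]
      rcases Nat.lt_or_eq_of_le hik with h | rfl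
      · rw [lof_apply_of_ne (by simp; omega), map_zero, sub_zero]
        exact h0 _ (by simp only; omega)
      · obtain rfl : j = m + 1 := by omega
        erw [DirectSum.lof_apply, hx]
        exact sub_self _
    obtain ⟨y', hy'⟩ := ih (k + 1) (by omega) _ hz' h0' fun hm => by
      -- With column `k + 1` cleared, only the horizontal term of the cycle equation at `(k + 1, m)`
      -- survives.
      have h := hz' (k + 1) m (by omega) hm (by omega)
      rwa [h0' ⟨(k + 1, m + 1), _⟩ le_rfl, map_zero, smul_zero, add_zero] at h
    exact ⟨y' + y, by rw [map_add, hy', sub_add_cancel]⟩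

/-- The hypothesis `hcol` is exactness of the complex of images of `X₁ ⊗ Y_j` in `X₀ ⊗ Y_j`. It
supplies a boundary that makes the entry in column 1 a horizontal cycle, after which the staircase
starts at `k = 0`. -/
theorem exists_posDiff_eq
    (hrow : ∀ i j, Function.Exact ((X.d (i + 2) (i + 1)).hom.rTensor (Y.X j))
      ((X.d (i + 1) i).hom.rTensor (Y.X j)))
    (hcol : ∀ n (x : X.X 1 ⊗[R] Y.X (n + 1)),
      (Y.d (n + 1) n).hom.lTensor (X.X 0) ((X.d 1 0).hom.rTensor (Y.X (n + 1)) x) = 0 →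
      ∃ y, (Y.d (n + 2) (n + 1)).hom.lTensor (X.X 0) ((X.d 1 0).hom.rTensor (Y.X (n + 2)) y) =
        (X.d 1 0).hom.rTensor (Y.X (n + 1)) x)
    {n : ℕ} {z : PosTerm X Y (n + 1)} (hz : IsPosCycle z)
    (h0 : (Y.d (n + 1) n).hom.lTensor (X.X 0) ((X.d 1 0).hom.rTensor (Y.X (n + 1))
      (z ⟨(1, n + 1), by simp only; omega⟩)) = 0) :
    ∃ y, posDiff X Y n y = z := by
  obtain ⟨x, hx⟩ := hcol n _ h0
  -- The sign of `-x` cancels the factor `(-1)^1` of the vertical differential in column 1.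
  let y := DirectSum.lof R (StarIdx (n + 2)) (fun q => X.X q.1.1 ⊗[R] Y.X q.1.2)
      ⟨(1, n + 2), by simp only; omega⟩ (-x)
  have hy : posDiff X Y n y ⟨(1, n + 1), by simp only; omega⟩ =
      (Y.d (n + 2) (n + 1)).hom.lTensor (X.X 1) x := by
    rw [posDiff_apply n 1 (n + 1) le_rfl (by omega) (by omega), lof_apply_of_ne (by simp), map_zero,
      zero_add, pow_one, neg_smul, one_smul]
    erw [DirectSum.lof_apply]
    rw [map_neg, neg_neg]
  obtain ⟨y', hy'⟩ := IsPosCycle.exists_posDiff_eq hrow (n + 1) 0 (by omega)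
    (z - posDiff X Y n y) (hz.sub (isPosCycle_posDiff _))
    (fun p hp => by have := p.2; omega) fun _ => by
      change (X.d 1 0).hom.rTensor _ ((z - posDiff X Y n y) ⟨(1, n + 1), _⟩) = 0
      rw [DirectSum.sub_apply, hy, map_sub, ← hx, ← LinearMap.comp_apply,
        ← LinearMap.comp_apply (LinearMap.rTensor _ _),
        LinearMap.lTensor_comp_rTensor, LinearMap.rTensor_comp_lTensor]
      exact sub_self _
  exact ⟨y' + y, by rw [map_add, hy', sub_add_cancel]⟩

end Exactness

/-! ## The star product is a free resolution -/

section Resolution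

variable {R : Type u} [CommRing R] {X Y : ChainComplex (ModuleCat.{u} R) ℕ}

theorem starProduct_d (n : ℕ) : (starProduct X Y).d (n + 1) n = starD X Y n :=
  ChainComplex.of_d ..

theorem augDiff_apply (z : PosTerm X Y 1) :
    augDiff X Y z = (Y.d 1 0).hom.lTensor (X.X 0)
      ((X.d 1 0).hom.rTensor (Y.X 1) (z ⟨(1, 1), by simp⟩)) := by
  induction z using DirectSum.induction_on with
  | zero => simp
  | add x y hx hy => rw [map_add, hx, hy, DirectSum.add_apply, map_add, map_add]
  | of p x =>
    obtain ⟨⟨i, j⟩, hp⟩ := p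
    obtain ⟨rfl, rfl⟩ : i = 1 ∧ j = 1 := by simp only at hp; omega
    rw [← DirectSum.lof_eq_of R, lof_apply_self, ← LinearMap.comp_apply (LinearMap.lTensor _ _),
      LinearMap.lTensor_comp_rTensor]
    exact DirectSum.toModule_lof ..

theorem augDiff_lof_tmul (hp : 1 ≤ 1 ∧ 1 ≤ 1 ∧ 1 + 1 = 1 + 1) (a : X.X 1) (b : Y.X 1) :
    augDiff X Y (DirectSum.lof R (StarIdx 1) (fun q => X.X q.1.1 ⊗[R] Y.X q.1.2)
      ⟨(1, 1), hp⟩ (a ⊗ₜ[R] b)) = (X.d 1 0).hom a ⊗ₜ[R] (Y.d 1 0).hom b :=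
  DirectSum.toModule_lof ..

theorem TorIndependent.exists_lTensor_rTensor_eq {I J : Ideal R} (hIJ : TorIndependent I J)
    (hX : IsFreeResolution X (R ⧸ I)) (hY : IsFreeResolution Y (R ⧸ J)) (n : ℕ)
    (x : X.X 1 ⊗[R] Y.X (n + 1))
    (hx : (Y.d (n + 1) n).hom.lTensor (X.X 0) ((X.d 1 0).hom.rTensor (Y.X (n + 1)) x) = 0) :
    ∃ y, (Y.d (n + 2) (n + 1)).hom.lTensor (X.X 0) ((X.d 1 0).hom.rTensor (Y.X (n + 2)) y) =
      (X.d 1 0).hom.rTensor (Y.X (n + 1)) x := by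
  obtain ⟨ε, hε, hexact⟩ := hX.augmentation
  have := hX.free 0
  have hker (m : ℕ) := rTensor_exact (Y.X m) hexact hε
  have hcomm (i j : ℕ) (w : X.X 0 ⊗[R] Y.X i) :
      ε.rTensor (Y.X j) ((Y.d i j).hom.lTensor (X.X 0) w) =
        (Y.d i j).hom.lTensor (R ⧸ I) (ε.rTensor (Y.X i) w) := by
    rw [← LinearMap.comp_apply, ← LinearMap.comp_apply, LinearMap.lTensor_comp_rTensor,
      LinearMap.rTensor_comp_lTensor]
  -- The image of `x` is a cycle of `X₀ ⊗ Y`, hence the boundary of some `w`. Modulo `I` this `w` is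
  -- a cycle, hence the boundary of some `v`; correcting `w` by a lift of `v` moves it into the
  -- image of `X₁ ⊗ Y`.
  obtain ⟨w, hw⟩ := (Module.Flat.lTensor_exact (X.X 0) (hY.exact n) _).mp hx
  have hεw : (Y.d (n + 2) (n + 1)).hom.lTensor (R ⧸ I) (ε.rTensor (Y.X (n + 2)) w) = 0 := by
    rw [← hcomm, hw]
    exact (hker _).apply_apply_eq_zero x
  obtain ⟨v, hv⟩ := (hIJ.lTensor_exact hY (n + 1) _).mp hεw
  obtain ⟨v, rfl⟩ := LinearMap.rTensor_surjective (Y.X (n + 3)) hε v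
  obtain ⟨y, hy⟩ := (hker (n + 2) (w - (Y.d (n + 3) (n + 2)).hom.lTensor (X.X 0) v)).mp (by
    rw [map_sub, hcomm, hv, sub_self])
  refine ⟨y, ?_⟩
  rw [hy, map_sub, hw, (Module.Flat.lTensor_exact (X.X 0)
    (hY.exact (n + 1))).apply_apply_eq_zero, sub_zero]

theorem TorIndependent.starProduct_exact {I J : Ideal R} (hIJ : TorIndependent I J)
    (hX : IsFreeResolution X (R ⧸ I)) (hY : IsFreeResolution Y (R ⧸ J)) (n : ℕ) :
    Function.Exact ((starProduct X Y).d (n + 2) (n + 1)).hom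
      ((starProduct X Y).d (n + 1) n).hom := by
  have hrow (i j : ℕ) : Function.Exact ((X.d (i + 2) (i + 1)).hom.rTensor (Y.X j))
      ((X.d (i + 1) i).hom.rTensor (Y.X j)) :=
    have := hY.free j
    Module.Flat.rTensor_exact (Y.X j) (hX.exact i)
  have hcol := hIJ.exists_lTensor_rTensor_eq hX hY
  rw [starProduct_d, starProduct_d]
  cases n with
  | zero =>
    refine LinearMap.exact_of_comp_of_mem_range (augDiff_comp_posDiff X Y) fun z hz => ?_
    exact exists_posDiff_eq hrow hcol (fun i j _ _ _ => by omega) ((augDiff_apply z).symm.trans hz)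
  | succ n =>
    refine LinearMap.exact_of_comp_of_mem_range (posDiff_comp_posDiff X Y n) fun z hz => ?_
    have hz' := (isPosCycle_iff z).mpr hz
    refine exists_posDiff_eq hrow hcol hz' ?_
    -- Applying `∂₁ ⊗ 1` to the cycle equation at `(1, n + 1)` kills the term coming from column 2.
    have h := congrArg ((X.d 1 0).hom.rTensor (Y.X (n + 1)))
      (hz' 1 (n + 1) le_rfl (by omega) (by omega))
    rw [map_add, (hrow 0 (n + 1)).apply_apply_eq_zero, map_zero, zero_add, pow_one, neg_smul,
      one_smul, map_neg, neg_eq_zero, ← LinearMap.comp_apply, LinearMap.rTensor_comp_lTensor] at h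
    rwa [← LinearMap.comp_apply, LinearMap.lTensor_comp_rTensor]

instance (n : ℕ) : Finite (StarIdx n) :=
  Set.Finite.to_subtype <| ((Set.finite_Iic (n + 1)).prod (Set.finite_Iic (n + 1))).subset
    fun p hp => by
      have := hp.out
      simp only [Set.mem_prod, Set.mem_Iic]
      omega

theorem starProduct_free (hX : ∀ n, Module.Free R (X.X n)) (hY : ∀ n, Module.Free R (Y.X n)) :
    ∀ n, Module.Free R ((starProduct X Y).X n)
  | 0 => inferInstanceAs (Module.Free R (X.X 0 ⊗[R] Y.X 0))
  | n + 1 => inferInstanceAs (Module.Free R (PosTerm X Y (n + 1)))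

theorem starProduct_finite (hX : ∀ n, Module.Finite R (X.X n))
    (hY : ∀ n, Module.Finite R (Y.X n)) : ∀ n, Module.Finite R ((starProduct X Y).X n)
  | 0 => inferInstanceAs (Module.Finite R (X.X 0 ⊗[R] Y.X 0))
  | n + 1 => inferInstanceAs (Module.Finite R (PosTerm X Y (n + 1)))

/-- The augmentation need not be the quotient map, but it sends `e.symm 1` to a generator of `R/I`,
and the annihilator of any generator is `I`. -/
theorem IsFreeResolution.mem_ideal_iff {I : Ideal R} (hX : IsFreeResolution X (R ⧸ I))
    (e : X.X 0 ≃ₗ[R] R) (r : R) : r ∈ I ↔ ∃ a, e ((X.d 1 0).hom a) = r := by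
  obtain ⟨ε, hε, hexact⟩ := hX.augmentation
  have hsmul (s : R) : ε (e.symm s) = s • ε (e.symm 1) := by
    rw [← map_smul, ← map_smul, smul_eq_mul, mul_one]
  have hr : (∃ a, e ((X.d 1 0).hom a) = r) ↔ ε (e.symm r) = 0 := by
    rw [hexact (e.symm r)]
    exact exists_congr fun a => (e.eq_symm_apply (x := r) (y := (X.d 1 0).hom a)).symm
  rw [hr, hsmul]
  constructor
  · intro h
    obtain ⟨q, hq⟩ := Ideal.Quotient.mk_surjective (ε (e.symm 1))
    rw [← hq, Algebra.smul_def, Ideal.Quotient.algebraMap_eq, Ideal.Quotient.eq_zero_iff_mem.mpr h,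
      zero_mul]
  · intro h
    obtain ⟨c, hc⟩ := hε 1
    rw [← Ideal.Quotient.eq_zero_iff_mem, ← mul_one (Ideal.Quotient.mk I r),
      ← Ideal.Quotient.algebraMap_eq, ← Algebra.smul_def, ← hc, ← e.symm_apply_apply c, hsmul,
      smul_comm, h, smul_zero]

theorem range_le_of_tmul_mem {n : ℕ} {N : Type*} [AddCommGroup N] [Module R N]
    (φ : PosTerm X Y n →ₗ[R] N) (S : Submodule R N)
    (h : ∀ (p : StarIdx n) (a : X.X p.1.1) (b : Y.X p.1.2), φ (DirectSum.lof R (StarIdx n)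
      (fun q => X.X q.1.1 ⊗[R] Y.X q.1.2) p (a ⊗ₜ[R] b)) ∈ S) :
    LinearMap.range φ ≤ S := by
  rintro _ ⟨z, rfl⟩
  induction z using DirectSum.induction_on with
  | zero => simp
  | add x y hx hy => exact map_add φ x y ▸ S.add_mem hx hy
  | of p x =>
    induction x with
    | zero => simp
    | add x y hx hy => simpa only [map_add] using S.add_mem hx hy
    | tmul a b => exact h p a b

theorem exists_augmentation_augDiff {I J : Ideal R} (hX : IsFreeResolution X (R ⧸ I))
    (hY : IsFreeResolution Y (R ⧸ J)) (e : X.X 0 ≃ₗ[R] R) (f : Y.X 0 ≃ₗ[R] R) :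
    ∃ ε : X.X 0 ⊗[R] Y.X 0 →ₗ[R] R ⧸ I * J,
      Function.Surjective ε ∧ Function.Exact (augDiff X Y) ε := by
  let φ := (TensorProduct.congr e f).trans (TensorProduct.lid R R)
  have hφ : Submodule.map φ.toLinearMap (LinearMap.range (augDiff X Y)) = I * J := by
    apply le_antisymm
    · rw [Submodule.map_le_iff_le_comap]
      refine range_le_of_tmul_mem _ _ fun p a b => ?_
      obtain ⟨⟨i, j⟩, hp⟩ := p
      obtain ⟨rfl, rfl⟩ : i = 1 ∧ j = 1 := by simp only at hp; omega
      rw [augDiff_lof_tmul hp]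
      exact Ideal.mul_mem_mul ((hX.mem_ideal_iff e _).mpr ⟨a, rfl⟩)
        ((hY.mem_ideal_iff f _).mpr ⟨b, rfl⟩)
    · refine Ideal.mul_le.mpr fun r hr s hs => ?_
      obtain ⟨a, rfl⟩ := (hX.mem_ideal_iff e r).mp hr
      obtain ⟨b, rfl⟩ := (hY.mem_ideal_iff f s).mp hs
      refine ⟨_, ⟨DirectSum.lof R (StarIdx 1) (fun q => X.X q.1.1 ⊗[R] Y.X q.1.2)
        ⟨(1, 1), by simp⟩ (a ⊗ₜ[R] b), augDiff_lof_tmul _ a b⟩, rfl⟩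
  refine ⟨(I * J).mkQ ∘ₗ φ.toLinearMap,
    (Submodule.mkQ_surjective _).comp φ.surjective, fun y => ?_⟩
  rw [LinearMap.comp_apply, Submodule.mkQ_apply, Submodule.Quotient.mk_eq_zero,
    ← hφ]
  exact φ.injective.mem_set_image (s := Set.range (augDiff X Y))

theorem TorIndependent.isFreeResolution_starProduct {I J : Ideal R} (hIJ : TorIndependent I J)
    (hX : IsFreeResolution X (R ⧸ I)) (e : X.X 0 ≃ₗ[R] R)
    (hY : IsFreeResolution Y (R ⧸ J)) (f : Y.X 0 ≃ₗ[R] R) :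
    IsFreeResolution (starProduct X Y) (R ⧸ I * J) where
  free := starProduct_free hX.free hY.free
  exact := hIJ.starProduct_exact hX hY
  augmentation := by
    rw [starProduct_d]
    exact exists_augmentation_augDiff hX hY e f

end Resolution

/-! ## Minimality -/

section Minimal

variable {R : Type u} [CommRing R] {X Y : ChainComplex (ModuleCat.{u} R) ℕ}

theorem IsMinimal.starProduct {𝔪 : Ideal R} (hX : IsMinimal 𝔪 X) (hY : IsMinimal 𝔪 Y) :
    IsMinimal 𝔪 (starProduct X Y) := by
  -- Each term of the differential is the image of some `∂a` or `∂b` under a linear map, and linear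
  -- maps preserve `𝔪 • ⊤`.
  have hmap {M N : Type u} [AddCommGroup M] [AddCommGroup N] [Module R M] [Module R N]
      (φ : M →ₗ[R] N) {x : M} (hx : x ∈ 𝔪 • (⊤ : Submodule R M)) :
      φ x ∈ 𝔪 • (⊤ : Submodule R N) :=
    Submodule.smul_top_le_comap_smul_top 𝔪 φ hx
  intro n
  rw [starProduct_d]
  cases n with
  | zero =>
    refine range_le_of_tmul_mem (augDiff X Y) _ fun p a b => ?_
    obtain ⟨⟨i, j⟩, hp⟩ := p
    obtain ⟨rfl, rfl⟩ : i = 1 ∧ j = 1 := by simp only at hp; omega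
    rw [augDiff_lof_tmul hp]
    exact hmap ((TensorProduct.mk R (X.X 0) (Y.X 0)).flip ((Y.d 1 0).hom b)) (hX 0 ⟨a, rfl⟩)
  | succ n =>
    refine range_le_of_tmul_mem (posDiff X Y n) _ fun p a b => ?_
    obtain ⟨⟨i, j⟩, hp⟩ := p
    obtain ⟨hi, hj, hij⟩ := hp
    simp only at hi hj hij a b
    -- Indices are written as successors so that `i + 1 - 1` reduces to `i` by definition.
    obtain ⟨i, rfl⟩ := Nat.exists_eq_add_of_le' hi
    obtain ⟨j, rfl⟩ := Nat.exists_eq_add_of_le' hj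
    rw [posDiff_lof]
    erw [starComponent_tmul]
    refine Submodule.add_mem _ ?_ ?_
    · split_ifs
      · exact hmap (DirectSum.lof R (StarIdx (n + 1)) (fun q => X.X q.1.1 ⊗[R] Y.X q.1.2)
          ⟨(i, j + 1), _⟩) (hmap ((TensorProduct.mk R (X.X i) (Y.X (j + 1))).flip b)
            (hX i ⟨a, rfl⟩))
      · exact Submodule.zero_mem _
    · split_ifs
      · exact Submodule.smul_mem _ _ <|
          hmap (DirectSum.lof R (StarIdx (n + 1)) (fun q => X.X q.1.1 ⊗[R] Y.X q.1.2)
          ⟨(i + 1, j), _⟩) (hmap (TensorProduct.mk R (X.X (i + 1)) (Y.X j) a)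
            (hY j ⟨b, rfl⟩))
      · exact Submodule.zero_mem _

end Minimal

/-! ## The grading -/

section GradedStar

variable {k : Type w} [Field k] {R : Type u} [CommRing R] [Algebra k R] (𝒜 : ℕ → Submodule k R)

theorem mul_mem_degreePart [SetLike.GradedMul 𝒜] {d e : ℤ} {r s : R}
    (hr : r ∈ degreePart 𝒜 d) (hs : s ∈ degreePart 𝒜 e) : r * s ∈ degreePart 𝒜 (d + e) := by
  unfold degreePart at *
  split_ifs at hr hs with hd he
  · rw [if_pos (by omega), Int.toNat_add hd he]
    exact SetLike.GradedMul.mul_mem hr hs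
  · rw [(Submodule.mem_bot k).mp hs, mul_zero]
    exact zero_mem _
  all_goals
    rw [(Submodule.mem_bot k).mp hr, zero_mul]
    exact zero_mem _

theorem one_mem_degreePart [SetLike.GradedOne 𝒜] : (1 : R) ∈ degreePart 𝒜 0 :=
  SetLike.GradedOne.one_mem (A := 𝒜)

/-- The homogeneous elements of degree `d` of the graded free module whose basis elements `b i`
have degree `δ i`. -/
def homogeneousPart {ι M : Type*} [AddCommGroup M] [Module R M] (b : Module.Basis ι R M)
    (δ : ι → ℤ) (d : ℤ) : AddSubgroup M where
  carrier := {x | ∀ i, b.repr x i ∈ degreePart 𝒜 (d - δ i)}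
  zero_mem' i := by simp
  add_mem' hx hy i := by simpa using add_mem (hx i) (hy i)
  neg_mem' hx i := by simpa using hx i

variable {𝒜} {ι κ M N : Type*} [AddCommGroup M] [Module R M] [AddCommGroup N] [Module R N]
  {b : Module.Basis ι R M} {c : Module.Basis κ R N} {δ : ι → ℤ} {γ : κ → ℤ} {d e : ℤ}

theorem basis_mem_homogeneousPart [SetLike.GradedOne 𝒜] (i : ι) :
    b i ∈ homogeneousPart 𝒜 b δ (δ i) := by
  classical
  intro j
  rw [b.repr_self, Finsupp.single_apply]
  split_ifs with h
  · rw [h, sub_self]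
    exact one_mem_degreePart 𝒜
  · exact zero_mem _

theorem tmul_mem_homogeneousPart [SetLike.GradedMul 𝒜] {x : M} {y : N}
    (hx : x ∈ homogeneousPart 𝒜 b δ d) (hy : y ∈ homogeneousPart 𝒜 c γ e) :
    x ⊗ₜ[R] y ∈ homogeneousPart 𝒜 (b.tensorProduct c) (fun p => δ p.1 + γ p.2) (d + e) := by
  rintro ⟨i, j⟩
  rw [Module.Basis.tensorProduct_repr_tmul_apply, smul_eq_mul, mul_comm, add_sub_add_comm]
  exact mul_mem_degreePart 𝒜 (hx i) (hy j)

theorem neg_one_pow_smul_mem_homogeneousPart {x : M} (hx : x ∈ homogeneousPart 𝒜 b δ d) (n : ℕ) :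
    (-1 : R) ^ n • x ∈ homogeneousPart 𝒜 b δ d := by
  rcases neg_one_pow_eq_or R n with h | h <;> simpa [h] using hx

theorem lof_mem_homogeneousPart {σ : Type*} [DecidableEq σ] {M : σ → Type*}
    [∀ s, AddCommGroup (M s)] [∀ s, Module R (M s)] {η : σ → Type*}
    {b : ∀ s, Module.Basis (η s) R (M s)} {δ : ∀ s, η s → ℤ} (s : σ) {x : M s}
    (hx : x ∈ homogeneousPart 𝒜 (b s) (δ s) d) :
    DirectSum.lof R σ M s x ∈ homogeneousPart 𝒜 (M := ⨁ s, M s) (DFinsupp.basis b)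
      (fun i : Σ s, η s => δ i.1 i.2) d := by
  rintro ⟨t, i⟩
  -- Coordinates with respect to `DFinsupp.basis` are by definition taken summand by summand.
  change (b t).repr ((DirectSum.lof R σ M s x) t) i ∈ _
  obtain rfl | h := eq_or_ne t s
  · rw [DirectSum.lof_apply]
    exact hx i
  · rw [show (DirectSum.lof R σ M s x) t = 0 from DFinsupp.single_eq_of_ne h, map_zero]
    exact zero_mem _

theorem basis_directSum_apply {σ : Type*} [DecidableEq σ] {M : σ → Type*}
    [∀ s, AddCommGroup (M s)] [∀ s, Module R (M s)] {η : σ → Type*}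
    (b : ∀ s, Module.Basis (η s) R (M s)) (i : Σ s, η s) :
    DFinsupp.basis b i = DirectSum.lof R σ M i.1 (b i.1 i.2) := by
  apply (DFinsupp.basis b).repr.injective
  refine Finsupp.ext fun ⟨t, j⟩ => ?_
  rw [Module.Basis.repr_self]
  change _ = (b t).repr ((DirectSum.lof R σ M i.1 (b i.1 i.2)) t) j
  obtain ⟨s, i⟩ := i
  obtain rfl | h := eq_or_ne t s
  · classical
    rw [DirectSum.lof_apply, Module.Basis.repr_self, Finsupp.single_apply, Finsupp.single_apply]
    simp
  · rw [show (DirectSum.lof R σ M s (b s i)) t = 0 from DFinsupp.single_eq_of_ne h, map_zero,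
      Finsupp.single_eq_of_ne (by simp [h])]
    rfl

theorem IsGradedFree.starProduct [GradedAlgebra 𝒜] {X Y : ChainComplex (ModuleCat.{u} R) ℕ}
    (hX : IsGradedFree 𝒜 X) (hY : IsGradedFree 𝒜 Y) : IsGradedFree 𝒜 (starProduct X Y) := by
  obtain ⟨ι, b, δ, hδ, hb⟩ := hX
  obtain ⟨κ, c, γ, hγ, hc⟩ := hY
  -- The matrix condition says by definition that `∂` sends a basis element to a homogeneous element
  -- of the same degree. The basis of `X ⋆ Y` consists of the tensors of basis elements, with
  -- degrees added.
  have hb' (n : ℕ) (i : ι (n + 1)) :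
      (X.d (n + 1) n).hom (b (n + 1) i) ∈ homogeneousPart 𝒜 (b n) (δ n) (δ (n + 1) i) := hb n i
  have hc' (n : ℕ) (i : κ (n + 1)) :
      (Y.d (n + 1) n).hom (c (n + 1) i) ∈ homogeneousPart 𝒜 (c n) (γ n) (γ (n + 1) i) := hc n i
  let ι' : ℕ → Type u
    | 0 => ι 0 × κ 0
    | n + 1 => Σ p : StarIdx (n + 1), ι p.1.1 × κ p.1.2
  let b₀ : Module.Basis (ι 0 × κ 0) R (X.X 0 ⊗[R] Y.X 0) := (b 0).tensorProduct (c 0)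
  let bs (n : ℕ) (p : StarIdx n) : Module.Basis (ι p.1.1 × κ p.1.2) R
      (X.X p.1.1 ⊗[R] Y.X p.1.2) := (b p.1.1).tensorProduct (c p.1.2)
  let δs (n : ℕ) (p : StarIdx n) (i : ι p.1.1 × κ p.1.2) : ℤ := δ p.1.1 i.1 + γ p.1.2 i.2
  let bPos (n : ℕ) : Module.Basis (Σ p : StarIdx n, ι p.1.1 × κ p.1.2) R (PosTerm X Y n) :=
    DFinsupp.basis (bs n)
  have hbPos (n : ℕ) (p : StarIdx n) (i : ι p.1.1) (j : κ p.1.2) :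
      bPos n ⟨p, i, j⟩ = DirectSum.lof R (StarIdx n) (fun q => X.X q.1.1 ⊗[R] Y.X q.1.2) p
        (b p.1.1 i ⊗ₜ[R] c p.1.2 j) := by
    rw [← Module.Basis.tensorProduct_apply]
    exact basis_directSum_apply (bs n) ⟨p, i, j⟩
  let b' : ∀ n, Module.Basis (ι' n) R ((StarResolution.starProduct X Y).X n)
    | 0 => b₀
    | n + 1 => bPos (n + 1)
  let δ' : ∀ n, ι' n → ℤ
    | 0 => fun i => δ 0 i.1 + γ 0 i.2
    | n + 1 => fun i => δs (n + 1) i.1 i.2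
  refine ⟨ι', b', δ', fun i => ?_, fun n => ?_⟩
  · change δ 0 _ + γ 0 _ = 0
    rw [hδ, hγ, add_zero]
  rw [starProduct_d]
  cases n with
  | zero =>
    rintro ⟨⟨⟨i, j⟩, hp⟩, s, t⟩
    obtain ⟨rfl, rfl⟩ : i = 1 ∧ j = 1 := by simp only at hp; omega
    change augDiff X Y (bPos 1 _) ∈ homogeneousPart 𝒜 b₀ (fun i => δ 0 i.1 + γ 0 i.2)
      (δ 1 s + γ 1 t)
    rw [hbPos, augDiff_lof_tmul hp]
    exact tmul_mem_homogeneousPart (hb' 0 s) (hc' 0 t)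
  | succ n =>
    rintro ⟨⟨⟨i, j⟩, hi, hj, hij⟩, s, t⟩
    simp only at hi hj hij s t
    obtain ⟨i, rfl⟩ := Nat.exists_eq_add_of_le' hi
    obtain ⟨j, rfl⟩ := Nat.exists_eq_add_of_le' hj
    change posDiff X Y n (bPos (n + 2) _) ∈ homogeneousPart 𝒜 (bPos (n + 1))
      (fun i => δs (n + 1) i.1 i.2) (δ (i + 1) s + γ (j + 1) t)
    rw [hbPos, posDiff_lof]
    erw [starComponent_tmul]
    refine add_mem ?_ ?_
    · split_ifs
      · exact lof_mem_homogeneousPart (b := bs (n + 1)) (δ := δs (n + 1)) ⟨(i, j + 1), _⟩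
          (tmul_mem_homogeneousPart (hb' i s) (basis_mem_homogeneousPart (𝒜 := 𝒜) t))
      · exact zero_mem _
    · split_ifs
      · exact neg_one_pow_smul_mem_homogeneousPart
          (lof_mem_homogeneousPart (b := bs (n + 1)) (δ := δs (n + 1)) ⟨(i + 1, j), _⟩
            (tmul_mem_homogeneousPart (basis_mem_homogeneousPart (𝒜 := 𝒜) s) (hc' j t))) _
      · exact zero_mem _

end GradedStar

end StarResolution

theorem theorem3p3 {R : Type u} [CommRing R] (I J : Ideal R)
    (hIJ : StarResolution.TorIndependent I J)
    (X Y : ChainComplex (ModuleCat.{u} R) ℕ)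
    (hX : StarResolution.IsFreeResolution X (R ⧸ I)) (hX₀ : Nonempty (X.X 0 ≃ₗ[R] R))
    (hY : StarResolution.IsFreeResolution Y (R ⧸ J)) (hY₀ : Nonempty (Y.X 0 ≃ₗ[R] R)) :
    -- `X ⋆ Y` is a free resolution of `R / IJ`, again with a free term of rank one in degree `0`
    StarResolution.IsFreeResolution (StarResolution.starProduct X Y) (R ⧸ I * J) ∧
    Nonempty ((StarResolution.starProduct X Y).X 0 ≃ₗ[R] R) ∧
    -- it consists of modules of finite rank if `X` and `Y` do
    ((∀ n, Module.Finite R (X.X n)) → (∀ n, Module.Finite R (Y.X n)) →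
      ∀ n, Module.Finite R ((StarResolution.starProduct X Y).X n)) ∧
    -- minimality over a local ring
    (∀ [IsLocalRing R],
      StarResolution.IsMinimal (IsLocalRing.maximalIdeal R) X →
      StarResolution.IsMinimal (IsLocalRing.maximalIdeal R) Y →
      StarResolution.IsMinimal (IsLocalRing.maximalIdeal R) (StarResolution.starProduct X Y)) ∧
    -- the grading, and minimality, over a standard graded ring
    (∀ {k : Type w} [Field k] [Algebra k R] (𝒜 : ℕ → Submodule k R) [GradedAlgebra 𝒜],
      StarResolution.IsStandardGraded 𝒜 →
      (StarResolution.IsGradedFree 𝒜 X → StarResolution.IsGradedFree 𝒜 Y →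
        StarResolution.IsGradedFree 𝒜 (StarResolution.starProduct X Y)) ∧
      (StarResolution.IsMinimal (HomogeneousIdeal.irrelevant 𝒜).toIdeal X →
        StarResolution.IsMinimal (HomogeneousIdeal.irrelevant 𝒜).toIdeal Y →
        StarResolution.IsMinimal (HomogeneousIdeal.irrelevant 𝒜).toIdeal
          (StarResolution.starProduct X Y))) := by
  obtain ⟨e⟩ := hX₀
  obtain ⟨f⟩ := hY₀
  exact ⟨hIJ.isFreeResolution_starProduct hX e hY f,
    ⟨(TensorProduct.congr e f).trans (TensorProduct.lid R R)⟩,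
    StarResolution.starProduct_finite, StarResolution.IsMinimal.starProduct,
    fun _ _ _ => ⟨StarResolution.IsGradedFree.starProduct, StarResolution.IsMinimal.starProduct⟩⟩
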